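/- Let $\mathcal H$ be a complex separable Hilbert space with inner product $\langle\cdot,\cdot\rangle$ (linear in the second argument) and let $A$ be a trace class operator on $\mathcal H$, that is, a compact operator for which the sum of its singular values (the positive eigenvalues of $|A|=(A^*A)^{1/2}$, counted with multiplicity) is finite. The determinant of $I+zT$, $z\in\mathbb C$, is $$\det(I+zT)=\sum_{n=0}^\infty z^n\,\mathrm{tr}\,{\textstyle\bigwedge^n}(T),\qquad \mathrm{tr}\,{\textstyle\bigwedge^n}(T)=\sum_{S\subset\iota,\ |S|=n}\det\big(\langle e_i,Te_j\rangle\big)_{i,j\in S},$$ evaluated in an arbitrary orthonormal basis $(e_i)_{i\in\iota}$ of $\mathcal H$. Let $(V_m)$ be a sequence of finite-dimensional subspaces of $\mathcal H$ with orthogonal projections $P_m:\mathcal H\to V_m$. Assume that $\bigcup_m V_m$ is dense in $\mathcal H$ and that the subspaces are nested, $V_m\subset V_{m+1}$ for all $m$, or, more generally, that $P_mx\to x$ for every $x\in\mathcal H$. Then all the series above converge absolutely for $T=A$ and for $T=P_mAP_m$; for every $m$, every orthonormal basis $\phi_1,\dots,\phi_d$ of $V_m$ and every $z\in\mathbb C$,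 $$\det(I+z\,P_mAP_m)=\det\big(\delta_{ij}+z\,\langle\phi_i,A\phi_j\rangle\big)_{i,j=1}^d;$$ and $$\det(I+z\,P_mAP_m)\to\det(I+z\,A)\qquad(m\to\infty)$$ uniformly for $z$ in any bounded subset of $\mathbb C$. -/

import Mathlib

noncomputable section

namespace FredholmDet

variable {H : Type*} [NormedAddCommGroup H] [InnerProductSpace ℂ H]
variable {ι : Type*}

/-- The multiplicity of the number `s > 0` as a singular value of `A`, that is, the dimension of
the eigenspace of `|A| = (A* A)^{1/2}` for `s`. For a compact operator `A` this eigenspace is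
finite-dimensional. -/
def singularMultiplicity [CompleteSpace H] (A : H →L[ℂ] H) (s : ℝ) : ℕ :=
  Module.finrank ℂ
    (Module.End.eigenspace ((CFC.abs A : H →L[ℂ] H) : H →ₗ[ℂ] H) (s : ℂ))

/-- Trace class operators: compact operators whose singular values (the positive eigenvalues
of `|A|`, counted with multiplicity) have a finite sum. -/
def IsTraceClass [CompleteSpace H] (A : H →L[ℂ] H) : Prop :=
  IsCompactOperator A ∧
    Summable fun s : {s : ℝ // 0 < s} => (s : ℝ) * (singularMultiplicity A s : ℝ)

open Classical in
/-- The principal minor `det (⟨eᵢ, A eⱼ⟩)` with `i, j ∈ S`. With `S = {i₁, …, iₙ}` and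
`e_S = e_{i₁} ∧ ⋯ ∧ e_{iₙ}`, this is the diagonal matrix element `⟨e_S, Λⁿ(A) e_S⟩`
of the exterior power `Λⁿ(A)`; see `pairing_exteriorPower_eq_principalMinor`. -/
def principalMinor (e : HilbertBasis ι ℂ H) (A : H →L[ℂ] H) (S : Finset ι) : ℂ :=
  Matrix.det (Matrix.of fun i j : S => inner ℂ (e i) (A (e j)))

/-- The `e_S`-coordinate of `Λⁿ(A) e_S` is the principal minor of `A` on `S`. -/
theorem pairing_exteriorPower_eq_principalMinor (e : HilbertBasis ι ℂ H) (A : H →L[ℂ] H)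
    {n : ℕ} (S : Finset ι) (i : Fin n ≃ S) :
    exteriorPower.pairingDual ℂ H n
        (exteriorPower.ιMulti ℂ n
          fun p => ((innerSL ℂ (e (i p)) : H →L[ℂ] ℂ) : Module.Dual ℂ H))
        (exteriorPower.map n (A : H →ₗ[ℂ] H)
          (exteriorPower.ιMulti ℂ n fun p => e (i p))) =
      principalMinor e A S := by
  classical
  rw [exteriorPower.map_apply_ιMulti, exteriorPower.pairingDual_ιMulti_ιMulti, principalMinor,
    ← Matrix.det_transpose, ← Matrix.det_submatrix_equiv_self i]
  congr 1

/-- The trace of the `n`-th exterior power `Λⁿ(A)`, evaluated in the orthonormal basis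
`e_S`, `S` ranging over the `n`-element subsets of `ι`, of `Λⁿ(H)`. -/
def traceExteriorPower (e : HilbertBasis ι ℂ H) (A : H →L[ℂ] H) (n : ℕ) : ℂ :=
  ∑' S : Set.powersetCard ι n, principalMinor e A (S : Finset ι)

/-- The operator determinant `det (I + z A) = ∑ₙ zⁿ tr Λⁿ(A)`, the traces being evaluated by means
of the orthonormal basis `e`. -/
def operatorDet (e : HilbertBasis ι ℂ H) (A : H →L[ℂ] H) (z : ℂ) : ℂ :=
  ∑' n : ℕ, z ^ n * traceExteriorPower e A n

/-- All series entering `operatorDet e A` converge (absolutely). -/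
def OperatorDetConverges (e : HilbertBasis ι ℂ H) (A : H →L[ℂ] H) : Prop :=
  (∀ n : ℕ, Summable fun S : Set.powersetCard ι n => principalMinor e A (S : Finset ι)) ∧
    ∀ z : ℂ, Summable fun n : ℕ => z ^ n * traceExteriorPower e A n

/-- The Galerkin projection `P A P`, where `P` is the orthogonal projection onto `V`. -/
def galerkinProjection (V : Submodule ℂ H) [V.HasOrthogonalProjection] (A : H →L[ℂ] H) :
    H →L[ℂ] H :=
  V.starProjection ∘L A ∘L V.starProjection

end FredholmDet

end

/-!
A trace class operator has an expansion `A = ∑ₖ ⟨yₖ, ·⟩ xₖ` with `∑ₖ ‖xₖ‖ ‖yₖ‖ < ∞`, for instance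
`yₖ` an eigenbasis of `|A|` and `xₖ = A yₖ`. Cauchy–Binet turns `tr Λⁿ(A)`, evaluated in any
orthonormal basis, into `(1 / n!) ∑ det ⟨y_{kₐ}, x_{k_b}⟩`, the sum being over `k₁, …, kₙ`, and
Hadamard's inequality bounds this by `(∑ₖ ‖xₖ‖ ‖yₖ‖)ⁿ / n!`. Since `P A P` has the expansion
`(P xₖ, P yₖ)`, its traces obey the same bound for every orthogonal projection `P`, so dominated
convergence applies first to each trace and then to the power series. Regarded as an expansion in
the range of `P`, the same vectors represent the compression of `A`, whose determinant is a
finite one.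
-/

namespace FredholmDet

open Filter Topology Module.End ContinuousLinearMap

section Product

variable {α κ 𝕜 : Type*} [Fintype α] [NormedField 𝕜]

theorem summable_norm_prod_apply {f : α → κ → 𝕜} (hf : ∀ a, Summable fun k => ‖f a k‖) :
    Summable fun k : α → κ => ‖∏ a, f a (k a)‖ := by
  classical
  simp only [norm_prod]
  refine summable_of_sum_le (c := ∏ a, ∑' k, ‖f a k‖)
    (fun _ => Finset.prod_nonneg fun _ _ => norm_nonneg _) fun s => ?_
  let t : α → Finset κ := fun a => s.image (· a)
  have hst : s ⊆ Fintype.piFinset t := fun k hk =>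
    Fintype.mem_piFinset.mpr fun a => Finset.mem_image_of_mem _ hk
  calc ∑ k ∈ s, ∏ a, ‖f a (k a)‖ ≤ ∑ k ∈ Fintype.piFinset t, ∏ a, ‖f a (k a)‖ :=
        Finset.sum_le_sum_of_subset_of_nonneg hst fun _ _ _ =>
          Finset.prod_nonneg fun _ _ => norm_nonneg _
    _ = ∏ a, ∑ k ∈ t a, ‖f a k‖ := (Finset.prod_univ_sum t fun a k => ‖f a k‖).symm
    _ ≤ ∏ a, ∑' k, ‖f a k‖ := by
        gcongr with a
        exact (hf a).sum_le_tsum _ fun _ _ => norm_nonneg _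

theorem hasSum_prod_apply [CompleteSpace 𝕜] {f : α → κ → 𝕜}
    (hf : ∀ a, Summable fun k => ‖f a k‖) :
    HasSum (fun k : α → κ => ∏ a, f a (k a)) (∏ a, ∑' k, f a k) := by
  classical
  have hs := (summable_norm_prod_apply hf).of_norm.hasSum
  have hcofinal : Tendsto (fun t : Finset κ => Fintype.piFinset fun _ : α => t) atTop atTop :=
    tendsto_atTop_finset_of_monotone
      (fun s t hst => Fintype.piFinset_subset _ _ fun _ => hst)
      fun k => ⟨Finset.univ.image k, by simp⟩
  have hprod : Tendsto (fun t : Finset κ => ∑ k ∈ Fintype.piFinset fun _ : α => t, ∏ a, f a (k a))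
      atTop (𝓝 (∏ a, ∑' k, f a k)) := by
    simp only [← Finset.prod_univ_sum]
    exact tendsto_finsetProd _ fun a _ => (hf a).of_norm.hasSum
  rwa [tendsto_nhds_unique (hs.comp hcofinal) hprod] at hs

variable [DecidableEq α]

theorem norm_det_le_sum_perm (M : Matrix α α 𝕜) :
    ‖M.det‖ ≤ ∑ σ : Equiv.Perm α, ∏ a, ‖M a (σ a)‖ := by
  rw [← Matrix.det_transpose, Matrix.det_apply]
  refine norm_sum_le_of_le _ fun σ _ => ?_
  rcases Int.units_eq_one_or (Equiv.Perm.sign σ) with h | h <;> simp [h, norm_prod]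

theorem summable_norm_det_rows {f : α → α → κ → 𝕜} (hf : ∀ a b, Summable fun j => ‖f a b j‖) :
    Summable fun i : α → κ => ‖Matrix.det (Matrix.of fun a b => f a b (i a))‖ := by
  refine Summable.of_nonneg_of_le (fun _ => norm_nonneg _) (fun i => norm_det_le_sum_perm _) ?_
  refine summable_sum fun σ _ => ?_
  simpa only [norm_prod] using! summable_norm_prod_apply fun a => hf a (σ a)

theorem tsum_norm_det_rows_le {f : α → α → κ → 𝕜} (hf : ∀ a b, Summable fun j => ‖f a b j‖) :
    ∑' i : α → κ, ‖Matrix.det (Matrix.of fun a b => f a b (i a))‖ ≤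
      ∑ σ : Equiv.Perm α, ∏ a, ∑' j, ‖f a (σ a) j‖ := by
  have hperm : HasSum (fun i : α → κ => ∑ σ : Equiv.Perm α, ∏ a, ‖f a (σ a) (i a)‖)
      (∑ σ : Equiv.Perm α, ∏ a, ∑' j, ‖f a (σ a) j‖) :=
    hasSum_sum fun σ _ => hasSum_prod_apply (f := fun a j => ‖f a (σ a) j‖) fun a => by
      simpa only [norm_norm] using hf a (σ a)
  rw [← hperm.tsum_eq]
  exact Summable.tsum_le_tsum (fun i => norm_det_le_sum_perm _) (summable_norm_det_rows hf)
    hperm.summable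

theorem hasSum_det_rows [CompleteSpace 𝕜] {f : α → α → κ → 𝕜}
    (hf : ∀ a b, Summable fun j => ‖f a b j‖) :
    HasSum (fun i : α → κ => Matrix.det (Matrix.of fun a b => f a b (i a)))
      (Matrix.det (Matrix.of fun a b => ∑' j, f a b j)) := by
  simp only [← Matrix.det_transpose (Matrix.of _), Matrix.det_apply]
  exact hasSum_sum fun σ _ => (hasSum_prod_apply fun a => hf a (σ a)).const_smul _

theorem hasSum_det_columns [CompleteSpace 𝕜] {f : α → α → κ → 𝕜}
    (hf : ∀ a b, Summable fun j => ‖f a b j‖) :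
    HasSum (fun i : α → κ => Matrix.det (Matrix.of fun a b => f a b (i b)))
      (Matrix.det (Matrix.of fun a b => ∑' j, f a b j)) := by
  simp only [← Matrix.det_transpose (Matrix.of _)]
  exact hasSum_det_rows fun a b => hf b a

end Product

section InnerProduct

variable {𝕜 E F : Type*} [RCLike 𝕜] [NormedAddCommGroup E] [InnerProductSpace 𝕜 E]
  [NormedAddCommGroup F] [InnerProductSpace 𝕜 F]

theorem norm_det_le_prod_norm {n : ℕ} (b : OrthonormalBasis (Fin n) 𝕜 E) (v : Fin n → E) :
    ‖b.toBasis.det v‖ ≤ ∏ i, ‖v i‖ := by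
  have : FiniteDimensional 𝕜 E := b.toBasis.finiteDimensional_of_finite
  let g := InnerProductSpace.gramSchmidtOrthonormalBasis (Module.finrank_eq_card_basis b.toBasis) v
  have hg : b.toBasis.det v = b.toBasis.det g.toBasis * g.toBasis.det v := by
    simp only [Module.Basis.det_apply, ← Matrix.det_mul, Module.Basis.toMatrix_mul_toMatrix]
  have hunit : ‖b.toBasis.det g.toBasis‖ = 1 := by simp
  rw [hg, norm_mul, hunit, one_mul, InnerProductSpace.gramSchmidtOrthonormalBasis_det, norm_prod]
  gcongr with i
  simpa only [g.norm_eq_one, one_mul] using norm_inner_le_norm (𝕜 := 𝕜) (g i) (v i)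

theorem exists_linearIsometry_of_finrank_le [FiniteDimensional 𝕜 E] [FiniteDimensional 𝕜 F]
    (h : Module.finrank 𝕜 E ≤ Module.finrank 𝕜 F) : Nonempty (E →ₗᵢ[𝕜] F) := by
  let b := stdOrthonormalBasis 𝕜 E
  let c := stdOrthonormalBasis 𝕜 F
  let f : E →ₗ[𝕜] F := b.toBasis.constr 𝕜 (c ∘ Fin.castLE h)
  have hf : f ∘ b.toBasis = c ∘ Fin.castLE h := funext (b.toBasis.constr_basis 𝕜 _)
  exact ⟨f.isometryOfOrthonormal (v := b.toBasis) (by simp)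
    (hf ▸ c.orthonormal.comp _ (Fin.castLE_injective h))⟩

theorem norm_det_inner_le {n : ℕ} (x y : Fin n → E) :
    ‖Matrix.det (Matrix.of fun a b => inner 𝕜 (y a) (x b))‖ ≤ ∏ a, ‖x a‖ * ‖y a‖ := by
  -- Only the projections of the `x a` to the span of the `y a` matter. This span embeds in `𝕜ⁿ`,
  -- where the matrix factors and Hadamard's inequality applies to both factors.
  let W := Submodule.span 𝕜 (Set.range y)
  have : FiniteDimensional 𝕜 W := FiniteDimensional.span_of_finite 𝕜 (Set.finite_range y)
  have hW : Module.finrank 𝕜 W ≤ Module.finrank 𝕜 (EuclideanSpace 𝕜 (Fin n)) := by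
    simpa [W] using! finrank_range_le_card (R := 𝕜) y
  obtain ⟨L⟩ := exists_linearIsometry_of_finrank_le hW
  let b := EuclideanSpace.basisFun (Fin n) 𝕜
  let x' : Fin n → EuclideanSpace 𝕜 (Fin n) := fun a => L (W.orthogonalProjectionOnto (x a))
  let y' : Fin n → EuclideanSpace 𝕜 (Fin n) := fun a =>
    L ⟨y a, Submodule.subset_span (Set.mem_range_self a)⟩
  have hinner : ∀ i j, inner 𝕜 (y i) (x j) = inner 𝕜 (y' i) (x' j) := fun i j => by
    simp [x', y', L.inner_map_map]
  have hmul : (Matrix.of fun i j => inner 𝕜 (y i) (x j)) =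
      (b.toBasis.toMatrix y').conjTranspose * b.toBasis.toMatrix x' := by
    ext i j
    simp [hinner, Matrix.mul_apply, Module.Basis.toMatrix_apply, b, PiLp.inner_apply, mul_comm]
  rw [hmul, Matrix.det_mul, Matrix.det_conjTranspose, norm_mul, norm_star, mul_comm,
    Finset.prod_mul_distrib]
  refine mul_le_mul ((norm_det_le_prod_norm b x').trans ?_) ((norm_det_le_prod_norm b y').trans ?_)
    (norm_nonneg _) (Finset.prod_nonneg fun _ _ => norm_nonneg _)
  · gcongr with a
    simpa [x'] using W.norm_orthogonalProjectionOnto_apply_le (x a)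
  · simp [y']

theorem sum_norm_inner_mul_inner_le {ι : Type*} {e : ι → E} (he : Orthonormal 𝕜 e) (u v : E)
    (s : Finset ι) : ∑ i ∈ s, ‖inner 𝕜 u (e i) * inner 𝕜 (e i) v‖ ≤ ‖u‖ * ‖v‖ :=
  calc ∑ i ∈ s, ‖inner 𝕜 u (e i) * inner 𝕜 (e i) v‖
      ≤ √(∑ i ∈ s, ‖inner 𝕜 u (e i)‖ ^ 2) * √(∑ i ∈ s, ‖inner 𝕜 (e i) v‖ ^ 2) := by
        simp only [norm_mul]
        exact Real.sum_mul_le_sqrt_mul_sqrt _ _ _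
    _ ≤ ‖u‖ * ‖v‖ := by
        simp only [norm_inner_symm u]
        gcongr <;> exact Real.sqrt_le_iff.mpr ⟨norm_nonneg _, he.sum_inner_products_le _⟩

theorem summable_norm_inner_mul_inner {ι : Type*} {e : ι → E} (he : Orthonormal 𝕜 e) (u v : E) :
    Summable fun i => ‖inner 𝕜 u (e i) * inner 𝕜 (e i) v‖ :=
  summable_of_sum_le (fun _ => norm_nonneg _) (sum_norm_inner_mul_inner_le he u v)

theorem tsum_norm_inner_mul_inner_le {ι : Type*} {e : ι → E} (he : Orthonormal 𝕜 e) (u v : E) :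
    ∑' i, ‖inner 𝕜 u (e i) * inner 𝕜 (e i) v‖ ≤ ‖u‖ * ‖v‖ :=
  Real.tsum_le_of_sum_le (fun _ => norm_nonneg _) (sum_norm_inner_mul_inner_le he u v)

end InnerProduct

section Compact

variable {𝕜 E F G : Type*} [RCLike 𝕜] [NormedAddCommGroup E] [NormedSpace 𝕜 E]
  [NormedAddCommGroup F] [NormedSpace 𝕜 F] [NormedAddCommGroup G] [NormedSpace 𝕜 G]

theorem isCompactOperator_of_norm_apply_le [CompleteSpace F] {S : E →L[𝕜] G} {T : E →L[𝕜] F}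
    (hS : IsCompactOperator S) (h : ∀ v, ‖T v‖ ≤ ‖S v‖) : IsCompactOperator T := by
  let B : Set E := Metric.closedBall 0 1
  have hSB : TotallyBounded (S '' B) :=
    (hS.isCompact_closure_image_closedBall (f := (S : E →ₗ[𝕜] G)) 1).totallyBounded.subset
      subset_closure
  have hTB : TotallyBounded (T '' B) := by
    refine Metric.totallyBounded_iff.mpr fun ε hε => ?_
    obtain ⟨t, htB, ht, hcover⟩ := Metric.finite_approx_of_totallyBounded hSB ε hε
    obtain ⟨u, -, hu, rfl⟩ := Set.exists_subset_image_finite_and.mp ⟨t, htB, ht, rfl⟩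
    refine ⟨T '' u, hu.image T, ?_⟩
    rintro _ ⟨v, hv, rfl⟩
    obtain ⟨w, hw, hvw⟩ : ∃ w ∈ u, S v ∈ Metric.ball (S w) ε := by
      simpa using hcover (Set.mem_image_of_mem S hv)
    refine Set.mem_biUnion (Set.mem_image_of_mem T hw) ?_
    rw [mem_ball_iff_norm, ← map_sub] at hvw ⊢
    exact (h _).trans_lt hvw
  exact (isCompactOperator_iff_isCompact_closure_image_closedBall (T : E →ₗ[𝕜] F) one_pos).mpr
    (hTB.closure.isCompact_of_isClosed isClosed_closure)

end Compact

section Spectral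

universe u

variable {𝕜 : Type*} {H : Type u} [RCLike 𝕜] [NormedAddCommGroup H] [InnerProductSpace 𝕜 H]
  [CompleteSpace H]

theorem exists_hilbertBasis_eigenvectors {T : H →L[𝕜] H} (hT : IsCompactOperator T)
    (hsymm : (T : H →ₗ[𝕜] H).IsSymmetric) :
    ∃ (κ : 𝕜 → Type u) (b : HilbertBasis (Σ μ, κ μ) 𝕜 H), (∀ p, T (b p) = p.1 • b p) ∧
      ∀ μ ≠ 0, Finite (κ μ) ∧ Nat.card (κ μ) = Module.finrank 𝕜 (eigenspace (T : H →ₗ[𝕜] H) μ) := by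
  choose w b _ using fun μ => exists_hilbertBasis 𝕜 (eigenspace (T : H →ₗ[𝕜] H) μ)
  let v : (Σ μ, w μ) → H := fun p => b p.1 p.2
  have hv : Orthonormal 𝕜 v :=
    hsymm.orthogonalFamily_eigenspaces.orthonormal_sigma_orthonormal fun μ => (b μ).orthonormal
  have hspan : (Submodule.span 𝕜 (Set.range v))ᗮ = ⊥ := by
    refine (Submodule.eq_bot_iff _).mpr fun z hz => ?_
    suffices h : z ∈ (⨆ μ, eigenspace (T : H →ₗ[𝕜] H) μ)ᗮ by
      rwa [orthogonalComplement_iSup_eigenspaces_eq_bot hT hsymm] at h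
    rw [← Submodule.iInf_orthogonal, Submodule.mem_iInf]
    intro μ x hx
    have hexpand := (b μ).hasSum_inner_mul_inner ⟨x, hx⟩
      ((eigenspace (T : H →ₗ[𝕜] H) μ).orthogonalProjectionOnto z)
    have hzero : ∀ i, inner 𝕜 (b μ i : H) z = 0 := fun i =>
      hz _ (Submodule.subset_span (Set.mem_range_self (⟨μ, i⟩ : Σ μ, w μ)))
    simp only [Submodule.inner_orthogonalProjectionOnto_eq_of_mem_left, hzero, mul_zero] at hexpand
    exact hexpand.unique hasSum_zero
  refine ⟨fun μ => w μ, HilbertBasis.mkOfOrthogonalEqBot hv hspan, fun p => ?_, fun μ hμ => ?_⟩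
  · rw [HilbertBasis.coe_mkOfOrthogonalEqBot]
    exact mem_eigenspace_iff.mp (b p.1 p.2).2
  · have := ContinuousLinearMap.finite_dimensional_eigenspace hT μ hμ
    have hfin : Finite (w μ) := (b μ).orthonormal.linearIndependent.finite
    have := Fintype.ofFinite (w μ)
    exact ⟨hfin, by
      rw [Module.finrank_eq_card_basis (b μ).toOrthonormalBasis.toBasis, Nat.card_eq_fintype_card]⟩

end Spectral

section TraceClass

universe u

variable {H : Type u} [NormedAddCommGroup H] [InnerProductSpace ℂ H] [CompleteSpace H]

theorem norm_abs_apply (A : H →L[ℂ] H) (v : H) : ‖CFC.abs A v‖ = ‖A v‖ := by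
  have h : adjoint (CFC.abs A) * CFC.abs A = adjoint A * A := by
    rw [(CFC.abs_nonneg A).isSelfAdjoint.adjoint_eq, CFC.abs_mul_abs, star_eq_adjoint]
  rw [← sq_eq_sq₀ (norm_nonneg _) (norm_nonneg _), apply_norm_sq_eq_inner_adjoint_right,
    apply_norm_sq_eq_inner_adjoint_right]
  exact congrArg (fun B : H →L[ℂ] H => RCLike.re (inner ℂ v (B v))) h

theorem IsTraceClass.summable_abs_eigenvalues {A : H →L[ℂ] H} (hA : IsTraceClass A) :
    Summable fun μ : ℂ =>
      Module.finrank ℂ (eigenspace ((CFC.abs A : H →L[ℂ] H) : H →ₗ[ℂ] H) μ) * ‖μ‖ := by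
  let ofPos : {s : ℝ // 0 < s} → ℂ := fun s => (s : ℝ)
  have hinj : Function.Injective ofPos := Complex.ofReal_injective.comp Subtype.val_injective
  have hpos : (CFC.abs A).IsPositive := (nonneg_iff_isPositive _).mp (CFC.abs_nonneg A)
  refine (hinj.summable_iff fun μ hμ => ?_).mp (hA.2.congr fun s => ?_)
  · rcases eq_or_ne μ 0 with rfl | hμ0
    · simp
    suffices h : eigenspace ((CFC.abs A : H →L[ℂ] H) : H →ₗ[ℂ] H) μ = ⊥ by
      rw [h, finrank_bot, Nat.cast_zero, zero_mul]
    by_contra h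
    replace h := hasEigenvalue_iff.mpr h
    obtain ⟨s, rfl⟩ := Complex.conj_eq_iff_real.mp (hpos.isSymmetric.conj_eigenvalue_eq_self h)
    have hs : 0 ≤ s := eigenvalue_nonneg_of_nonneg h fun x => hpos.re_inner_nonneg_right x
    exact hμ ⟨⟨s, hs.lt_of_ne' (by simpa using hμ0)⟩, rfl⟩
  · simp [ofPos, singularMultiplicity, abs_of_pos s.2, mul_comm]

theorem IsTraceClass.exists_hilbertBasis_summable_norm {A : H →L[ℂ] H} (hA : IsTraceClass A) :
    ∃ (κ : Type u) (b : HilbertBasis κ ℂ H), Summable fun k => ‖A (b k)‖ := by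
  have hcompact : IsCompactOperator (CFC.abs A : H →L[ℂ] H) :=
    isCompactOperator_of_norm_apply_le hA.1 fun v => (norm_abs_apply A v).le
  have hpos : (CFC.abs A).IsPositive := (nonneg_iff_isPositive _).mp (CFC.abs_nonneg A)
  obtain ⟨κ, b, hb, hκ⟩ := exists_hilbertBasis_eigenvectors hcompact hpos.isSymmetric
  have hnorm : ∀ p, ‖A (b p)‖ = ‖p.1‖ := fun p => by
    rw [← norm_abs_apply, hb, norm_smul, b.orthonormal.1, mul_one]
  refine ⟨_, b, ?_⟩
  simp only [hnorm]
  rw [summable_sigma_of_nonneg fun p => norm_nonneg _]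
  refine ⟨fun μ => ?_, hA.summable_abs_eigenvalues.congr fun μ => ?_⟩
  · rcases eq_or_ne μ 0 with rfl | hμ
    · simp
    · have := (hκ μ hμ).1
      exact summable_of_hasFiniteSupport (Set.toFinite _)
  · rcases eq_or_ne μ 0 with rfl | hμ
    · simp
    · simp only [tsum_const, (hκ μ hμ).2, nsmul_eq_mul]

end TraceClass

section NuclearExpansion

open scoped Nat

variable {𝕜 H K ι κ : Type*} [RCLike 𝕜] [NormedAddCommGroup H] [InnerProductSpace 𝕜 H]
  [NormedAddCommGroup K] [InnerProductSpace 𝕜 K]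

/-- `A = ∑ₖ ⟨yₖ, ·⟩ xₖ`, the series converging weakly, with `∑ₖ ‖xₖ‖ ‖yₖ‖ < ∞`. Operators having
such an expansion are the nuclear ones. -/
structure HasNuclearExpansion (A : H →L[𝕜] H) (x y : κ → H) : Prop where
  summable : Summable fun k => ‖x k‖ * ‖y k‖
  hasSum_inner : ∀ u v, HasSum (fun k => inner 𝕜 u (x k) * inner 𝕜 (y k) v) (inner 𝕜 u (A v))

theorem hasNuclearExpansion_of_hilbertBasis [CompleteSpace H] {A : H →L[𝕜] H}
    (b : HilbertBasis κ 𝕜 H) (hA : Summable fun k => ‖A (b k)‖) :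
    HasNuclearExpansion A (fun k => A (b k)) b where
  summable := by simpa only [b.orthonormal.1, mul_one] using hA
  hasSum_inner u v := by
    simpa only [adjoint_inner_left] using b.hasSum_inner_mul_inner (adjoint A u) v

theorem HasNuclearExpansion.comp [CompleteSpace H] [CompleteSpace K] {A : H →L[𝕜] H}
    {x y : κ → H} (hA : HasNuclearExpansion A x y) (C : H →L[𝕜] K) (B : K →L[𝕜] H) :
    HasNuclearExpansion (C ∘L A ∘L B) (fun k => C (x k)) (fun k => adjoint B (y k)) where
  summable := by
    refine (hA.summable.mul_left (‖C‖ * ‖adjoint B‖)).of_nonneg_of_le (fun k => by positivity)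
      fun k => ?_
    rw [mul_mul_mul_comm]
    gcongr <;> exact le_opNorm _ _
  hasSum_inner u v := by
    simpa only [adjoint_inner_left, adjoint_inner_right] using!
      hA.hasSum_inner (adjoint C u) (B v)

/-- If `A = ∑ₖ ⟨yₖ, ·⟩ xₖ` then this is the trace of `Λⁿ(A)`: expanding
`A v₁ ∧ ⋯ ∧ A vₙ` multilinearly exhibits `Λⁿ(A)` as a sum of rank-one operators with traces
`det ⟨y_{kₐ}, x_{k_b}⟩`, in which each one occurs `n!` times. -/
noncomputable def expansionTrace (𝕜 : Type*) {H κ : Type*} [RCLike 𝕜] [NormedAddCommGroup H]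
    [InnerProductSpace 𝕜 H] (x y : κ → H) (n : ℕ) : 𝕜 :=
  (n ! : 𝕜)⁻¹ * ∑' k : Fin n → κ, Matrix.det (Matrix.of fun a b => inner 𝕜 (y (k a)) (x (k b)))

theorem norm_expansionTrace_le {x y : κ → H} {c : κ → ℝ} (hxy : ∀ k, ‖x k‖ * ‖y k‖ ≤ c k)
    (hc : Summable c) (n : ℕ) : ‖expansionTrace 𝕜 x y n‖ ≤ (∑' k, c k) ^ n / n ! := by
  have hprod := hasSum_prod_apply fun _ : Fin n => hc.norm
  rw [Finset.prod_const, Finset.card_univ, Fintype.card_fin] at hprod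
  rw [expansionTrace, norm_mul, norm_inv, RCLike.norm_natCast, inv_mul_eq_div]
  gcongr
  refine tsum_of_norm_bounded hprod fun k => (norm_det_inner_le _ _).trans ?_
  gcongr with a
  exact hxy _

theorem tendsto_expansionTrace {α : Type*} {l : Filter α} {x y : κ → H} {x' y' : α → κ → H}
    {c : κ → ℝ} (hbound : ∀ m k, ‖x' m k‖ * ‖y' m k‖ ≤ c k) (hc : Summable c)
    (hx : ∀ k, Tendsto (fun m => x' m k) l (𝓝 (x k)))
    (hy : ∀ k, Tendsto (fun m => y' m k) l (𝓝 (y k))) (n : ℕ) :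
    Tendsto (fun m => expansionTrace 𝕜 (x' m) (y' m) n) l (𝓝 (expansionTrace 𝕜 x y n)) := by
  refine Tendsto.const_mul _ (tendsto_tsum_of_dominated_convergence
    (hasSum_prod_apply fun _ : Fin n => hc.norm).summable (fun k => ?_)
    (Eventually.of_forall fun m k => (norm_det_inner_le _ _).trans ?_))
  · have hmatrix : Tendsto (fun m => Matrix.of fun a b => inner 𝕜 (y' m (k a)) (x' m (k b))) l
        (𝓝 (Matrix.of fun a b => inner 𝕜 (y (k a)) (x (k b)))) :=
      tendsto_pi_nhds.mpr fun a => tendsto_pi_nhds.mpr fun b => (hy (k a)).inner (hx (k b))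
    exact (continuous_id.matrix_det.tendsto _).comp hmatrix
  · gcongr with a
    exact hbound _ _

variable {A : H →L[𝕜] H} {x y : κ → H} {α : Type*} [Fintype α] [DecidableEq α]

theorem summable_norm_det_inner_mul_inner {e : ι → H} (he : Orthonormal 𝕜 e)
    (hxy : Summable fun k => ‖x k‖ * ‖y k‖) :
    Summable fun p : (α → κ) × (α → ι) => ‖Matrix.det (Matrix.of fun a b =>
      inner 𝕜 (y (p.1 a)) (e (p.2 a)) * inner 𝕜 (e (p.2 a)) (x (p.1 b)))‖ := by
  have hrow : ∀ (k : α → κ) (a b : α), Summable fun j =>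
      ‖inner 𝕜 (y (k a)) (e j) * inner 𝕜 (e j) (x (k b))‖ :=
    fun k a b => summable_norm_inner_mul_inner he _ _
  refine (summable_prod_of_nonneg fun p => norm_nonneg _).mpr
    ⟨fun k => (summable_norm_det_rows (hrow k) :), ?_⟩
  have hprod : Summable fun k : α → κ =>
      ((Fintype.card α)! : ℝ) * ‖∏ a, ‖x (k a)‖ * ‖y (k a)‖‖ :=
    (summable_norm_prod_apply fun _ => hxy.norm).mul_left _
  refine hprod.of_nonneg_of_le (fun k => tsum_nonneg fun _ => norm_nonneg _) fun k => ?_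
  calc _ ≤ ∑ σ : Equiv.Perm α, ∏ a,
          ∑' j, ‖inner 𝕜 (y (k a)) (e j) * inner 𝕜 (e j) (x (k (σ a)))‖ :=
        (tsum_norm_det_rows_le (hrow k) :)
    _ ≤ ∑ σ : Equiv.Perm α, ∏ a, ‖y (k a)‖ * ‖x (k (σ a))‖ := by
        gcongr with σ _ a
        exact tsum_norm_inner_mul_inner_le he _ _
    _ = (Fintype.card α)! * ‖∏ a, ‖x (k a)‖ * ‖y (k a)‖‖ := by
        have hσ : ∀ σ : Equiv.Perm α, ∏ a, ‖x (k (σ a))‖ = ∏ a, ‖x (k a)‖ := fun σ =>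
          Equiv.prod_comp σ fun a => ‖x (k a)‖
        simp [Finset.prod_mul_distrib, hσ, Fintype.card_perm, mul_comm]

theorem det_inner_mul_inner_rows_eq_columns (e : ι → H) (k : α → κ) (i : α → ι) :
    Matrix.det (Matrix.of fun a b => inner 𝕜 (y (k a)) (e (i a)) * inner 𝕜 (e (i a)) (x (k b))) =
      Matrix.det (Matrix.of fun a b =>
        inner 𝕜 (e (i a)) (x (k b)) * inner 𝕜 (y (k b)) (e (i b))) := by
  simp only [mul_comm (inner 𝕜 (e _) (x _))]
  exact (Matrix.det_mul_column (fun a => inner 𝕜 (y (k a)) (e (i a)))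
    (Matrix.of fun a b => inner 𝕜 (e (i a)) (x (k b)))).trans (Matrix.det_mul_row _ _).symm

/-- The Cauchy–Binet argument: sum `det (⟨y_{kₐ}, e_{iₐ}⟩ ⟨e_{iₐ}, x_{k_b}⟩)` over `i` and `k` in
both orders, using multilinearity in the rows for `i` and, after moving `⟨y_{kₐ}, e_{iₐ}⟩` from
row `a` to column `a`, multilinearity in the columns for `k`. -/
theorem HasNuclearExpansion.hasSum_det_inner (hA : HasNuclearExpansion A x y)
    (e : HilbertBasis ι 𝕜 H) :
    HasSum (fun i : α → ι => Matrix.det (Matrix.of fun a b => inner 𝕜 (e (i a)) (A (e (i b)))))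
      (∑' k : α → κ, Matrix.det (Matrix.of fun a b => inner 𝕜 (y (k a)) (x (k b)))) := by
  have hG := (summable_norm_det_inner_mul_inner (α := α) e.orthonormal hA.summable).of_norm.hasSum
  have hfst := hG.prod_fiberwise fun k => (hasSum_det_rows fun a b =>
    summable_norm_inner_mul_inner e.orthonormal (y (k a)) (x (k b)) :)
  have hsnd := ((Equiv.prodComm _ _).hasSum_iff.mpr hG).prod_fiberwise fun i => by
    simp only [Function.comp_apply, Equiv.prodComm_apply, Prod.fst_swap, Prod.snd_swap,
      det_inner_mul_inner_rows_eq_columns]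
    exact (hasSum_det_columns fun a b =>
      (hA.hasSum_inner (e (i a)) (e (i b))).summable.norm :)
  simp only [(e.hasSum_inner_mul_inner _ _).tsum_eq] at hfst
  simpa only [(hA.hasSum_inner _ _).tsum_eq, hfst.tsum_eq] using hsnd

end NuclearExpansion

section Determinant

open scoped Nat

variable {H ι κ : Type*} [NormedAddCommGroup H] [InnerProductSpace ℂ H]

theorem bijective_sigma_equiv_toEmbedding (ι : Type*) (n : ℕ) : Function.Bijective
    fun p : Σ S : Set.powersetCard ι n, Fin n ≃ (S : Finset ι) =>
      p.2.toEmbedding.trans (Function.Embedding.subtype (· ∈ (p.1 : Finset ι))) := by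
  have hrange : ∀ (S : Set.powersetCard ι n) (ε : Fin n ≃ (S : Finset ι)),
      Set.range (fun a => (ε a : ι)) = (S : Finset ι) := fun S ε => by
    exact (ε.surjective.range_comp Subtype.val).trans Subtype.range_coe
  refine ⟨fun ⟨S, ε⟩ ⟨S', ε'⟩ h => ?_, fun f => ?_⟩
  · have hcoe : (fun a => (ε a : ι)) = fun a => (ε' a : ι) := congrArg DFunLike.coe h
    obtain rfl : S = S' :=
      Subtype.ext (Finset.coe_injective ((hrange S ε).symm.trans (hcoe ▸ hrange S' ε')))
    obtain rfl : ε = ε' := Equiv.ext fun a => Subtype.ext (congrFun hcoe a)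
    rfl
  · let ε : Fin n ≃ (Set.powersetCard.ofFinEmb n ι f : Finset ι) :=
      (Equiv.ofInjective f f.injective).trans (Equiv.subtypeEquivRight fun i => by simp)
    exact ⟨⟨Set.powersetCard.ofFinEmb n ι f, ε⟩, rfl⟩

theorem det_submatrix_eq_principalMinor (e : HilbertBasis ι ℂ H) (A : H →L[ℂ] H) {n : ℕ}
    (S : Finset ι) (ε : Fin n ≃ S) :
    Matrix.det (Matrix.of fun a b => inner ℂ (e (ε a)) (A (e (ε b)))) = principalMinor e A S := by
  classical
  rw [principalMinor, ← Matrix.det_submatrix_equiv_self ε]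
  congr!

variable {A : H →L[ℂ] H} {x y : κ → H}

theorem HasNuclearExpansion.hasSum_principalMinor (hA : HasNuclearExpansion A x y)
    (e : HilbertBasis ι ℂ H) (n : ℕ) :
    HasSum (fun S : Set.powersetCard ι n => principalMinor e A (S : Finset ι))
      (expansionTrace ℂ x y n) := by
  -- Index tuples with a repetition contribute `0`; each `n`-element set comes from `n!` others.
  have hemb : HasSum (fun f : Fin n ↪ ι =>
      Matrix.det (Matrix.of fun a b => inner ℂ (e (f a)) (A (e (f b)))))
      (∑' k : Fin n → κ, Matrix.det (Matrix.of fun a b => inner ℂ (y (k a)) (x (k b)))) := by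
    refine (Function.Injective.hasSum_iff (f := fun i : Fin n → ι => Matrix.det
      (Matrix.of fun a b => inner ℂ (e (i a)) (A (e (i b))))) (g := fun f : Fin n ↪ ι => ⇑f)
      DFunLike.coe_injective fun i hi => ?_).mpr (hA.hasSum_det_inner e)
    have hi' : ¬ Function.Injective i := fun h => hi ⟨⟨i, h⟩, rfl⟩
    obtain ⟨a, b, hab, hne⟩ := Function.not_injective_iff.mp hi'
    exact Matrix.det_zero_of_row_eq hne (by ext; simp [hab])
  have hsigma : HasSum (fun p : Σ S : Set.powersetCard ι n, Fin n ≃ (S : Finset ι) =>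
      principalMinor e A (p.1 : Finset ι))
      (∑' k : Fin n → κ, Matrix.det (Matrix.of fun a b => inner ℂ (y (k a)) (x (k b)))) := by
    convert
      (Equiv.ofBijective _ (bijective_sigma_equiv_toEmbedding ι n)).hasSum_iff.mpr hemb using 2
    exact (det_submatrix_eq_principalMinor e A _ _).symm
  have hfiber : HasSum (fun S : Set.powersetCard ι n => (n ! : ℂ) * principalMinor e A S) _ :=
    hsigma.sigma fun S => by
      classical
      have hcard : Fintype.card (Fin n ≃ (S : Finset ι)) = n ! := by
        rw [Fintype.card_equiv (Finset.equivFinOfCardEq (Set.powersetCard.card_eq S)).symm,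
          Fintype.card_fin]
      simpa [hcard] using hasSum_fintype fun _ : Fin n ≃ (S : Finset ι) => principalMinor e A S
  have hn : (n ! : ℂ) ≠ 0 := Nat.cast_ne_zero.mpr n.factorial_ne_zero
  simpa only [expansionTrace, inv_mul_cancel_left₀ hn] using hfiber.mul_left (n ! : ℂ)⁻¹

theorem HasNuclearExpansion.operatorDet_eq (hA : HasNuclearExpansion A x y)
    (e : HilbertBasis ι ℂ H) (z : ℂ) :
    operatorDet e A z = ∑' n, z ^ n * expansionTrace ℂ x y n := by
  simp only [operatorDet, traceExteriorPower, (hA.hasSum_principalMinor e _).tsum_eq]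

theorem HasNuclearExpansion.operatorDetConverges (hA : HasNuclearExpansion A x y)
    (e : HilbertBasis ι ℂ H) : OperatorDetConverges e A := by
  refine ⟨fun n => (hA.hasSum_principalMinor e n).summable, fun z => ?_⟩
  refine (Real.summable_pow_div_factorial (‖z‖ * ∑' k, ‖x k‖ * ‖y k‖)).of_norm_bounded fun n => ?_
  rw [traceExteriorPower, (hA.hasSum_principalMinor e n).tsum_eq, norm_mul, norm_pow, mul_pow,
    mul_div_assoc]
  gcongr
  exact norm_expansionTrace_le (fun k => le_rfl) hA.summable n

theorem traceExteriorPower_eq_coeff_det {n : Type*} [Fintype n] [DecidableEq n]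
    (e : HilbertBasis n ℂ H) (A : H →L[ℂ] H) (k : ℕ) :
    traceExteriorPower e A k = (Matrix.det (1 + (Polynomial.X : Polynomial ℂ) •
      (Matrix.of fun i j => inner ℂ (e i) (A (e j))).map Polynomial.C)).coeff k := by
  have hminor : ∀ S : Finset n, ((Matrix.of fun i j => inner ℂ (e i) (A (e j))).submatrix
      (Subtype.val : S → n) Subtype.val).det = principalMinor e A S := fun S => by
    rw [principalMinor]
    congr!
  simp only [Matrix.coeff_det_one_add_X_smul_eq_sum_minors, traceExteriorPower, hminor]
  rw [← Finset.tsum_subtype]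
  exact ((Equiv.subtypeEquivRight fun S => by simp [Set.powersetCard]).tsum_eq _).symm

theorem operatorDet_of_fintype {n : Type*} [Fintype n] [DecidableEq n]
    (e : HilbertBasis n ℂ H) (A : H →L[ℂ] H) (z : ℂ) :
    operatorDet e A z = Matrix.det (1 + z • Matrix.of fun i j => inner ℂ (e i) (A (e j))) := by
  let M : Matrix n n ℂ := Matrix.of fun i j => inner ℂ (e i) (A (e j))
  let p : Polynomial ℂ := Matrix.det (1 + (Polynomial.X : Polynomial ℂ) • M.map Polynomial.C)
  have heval : p.eval z = Matrix.det (1 + z • M) := by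
    rw [← Polynomial.coe_evalRingHom, RingHom.map_det]
    congr 1
    ext i j
    by_cases h : i = j <;> simp [h, mul_comm z]
  calc operatorDet e A z = ∑' k, z ^ k * p.coeff k := by
        simp only [operatorDet, traceExteriorPower_eq_coeff_det, p, M]
    _ = ∑ k ∈ Finset.range (p.natDegree + 1), z ^ k * p.coeff k := tsum_eq_sum fun k hk => by
        rw [Polynomial.coeff_eq_zero_of_natDegree_lt (by simpa using hk), mul_zero]
    _ = p.eval z := by simp only [Polynomial.eval_eq_sum_range, mul_comm]
    _ = _ := heval

end Determinant

section Galerkin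

variable {H ι κ : Type*} [NormedAddCommGroup H] [InnerProductSpace ℂ H] [CompleteSpace H]
  {A : H →L[ℂ] H} {x y : κ → H}

theorem HasNuclearExpansion.galerkinProjection (hA : HasNuclearExpansion A x y)
    (V : Submodule ℂ H) [V.HasOrthogonalProjection] :
    HasNuclearExpansion (galerkinProjection V A) (fun k => V.starProjection (x k))
      (fun k => V.starProjection (y k)) := by
  simpa only [V.starProjection_isSymmetric.clm_adjoint_eq] using!
    hA.comp V.starProjection V.starProjection

theorem HasNuclearExpansion.operatorDet_galerkinProjection (hA : HasNuclearExpansion A x y)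
    (e : HilbertBasis ι ℂ H) {V : Submodule ℂ H} [V.HasOrthogonalProjection] {n : Type*}
    [Fintype n] [DecidableEq n] (φ : OrthonormalBasis n ℂ V) (z : ℂ) :
    operatorDet e (FredholmDet.galerkinProjection V A) z =
      Matrix.det (1 + z • Matrix.of fun i j => inner ℂ (φ i : H) (A (φ j))) := by
  have : FiniteDimensional ℂ V := φ.toBasis.finiteDimensional_of_finite
  have hcompression := hA.comp V.orthogonalProjectionOnto V.subtypeL
  rw [Submodule.adjoint_subtypeL] at hcompression
  -- The traces of `P A P` and of the compression are the same function of the same inner products,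
  -- hence the first step.
  calc operatorDet e (FredholmDet.galerkinProjection V A) z
      = ∑' n, z ^ n * expansionTrace ℂ (fun k => V.orthogonalProjectionOnto (x k))
          (fun k => V.orthogonalProjectionOnto (y k)) n :=
        (hA.galerkinProjection V).operatorDet_eq e z
    _ = Matrix.det (1 + z • Matrix.of fun i j => inner ℂ (φ.toHilbertBasis i)
          (V.orthogonalProjectionOnto (A (φ.toHilbertBasis j)))) :=
        (hcompression.operatorDet_eq φ.toHilbertBasis z).symm.trans (operatorDet_of_fintype _ _ z)
    _ = _ := by simp

end Galerkin

theorem tendstoUniformlyOn_tsum_pow_mul {α 𝕜 : Type*} [NormedField 𝕜] [CompleteSpace 𝕜]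
    {l : Filter α} {d : ℕ → 𝕜} {d' : α → ℕ → 𝕜} {c : ℕ → ℝ} {R : ℝ}
    (hc : Summable fun n => R ^ n * c n) (hbound : ∀ m n, ‖d' m n‖ ≤ c n)
    (hlim : ∀ n, Tendsto (fun m => d' m n) l (𝓝 (d n))) :
    TendstoUniformlyOn (fun m z => ∑' n, z ^ n * d' m n) (fun z => ∑' n, z ^ n * d n) l
      (Metric.closedBall 0 R) := by
  rcases l.eq_or_neBot with rfl | _
  · exact fun _ _ => eventually_bot
  rcases lt_or_ge R 0 with hR | hR
  · simp [Metric.closedBall_eq_empty.mpr hR, tendstoUniformlyOn_empty]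
  have hbound_lim : ∀ n, ‖d n‖ ≤ c n := fun n =>
    le_of_tendsto (hlim n).norm (Eventually.of_forall fun m => hbound m n)
  have hdist : ∀ m n, ‖R ^ n * ‖d n - d' m n‖‖ ≤ 2 * (R ^ n * c n) := fun m n => by
    rw [Real.norm_of_nonneg (by positivity), mul_left_comm, two_mul]
    gcongr
    exact norm_sub_le_of_le (hbound_lim n) (hbound m n)
  have hzero : Tendsto (fun m => ∑' n, R ^ n * ‖d n - d' m n‖) l (𝓝 0) := by
    rw [← tsum_zero (β := ℕ)]
    refine tendsto_tsum_of_dominated_convergence (hc.mul_left 2) (fun n => ?_)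
      (Eventually.of_forall hdist)
    simpa using ((tendsto_const_nhds.sub (hlim n)).norm.const_mul (R ^ n) :
      Tendsto (fun m => R ^ n * ‖d n - d' m n‖) l _)
  have hpow : ∀ z ∈ Metric.closedBall (0 : 𝕜) R, ∀ {f : ℕ → 𝕜} {g : ℕ → ℝ}, (∀ n, ‖f n‖ ≤ g n) →
      ∀ n, ‖z ^ n * f n‖ ≤ R ^ n * g n := fun z hz f g hfg n => by
    rw [norm_mul, norm_pow]
    gcongr
    exacts [mem_closedBall_zero_iff.mp hz, hfg n]
  refine Metric.tendstoUniformlyOn_iff.mpr fun ε hε => (hzero.eventually_lt_const hε).mono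
    fun m hm z hz => lt_of_le_of_lt ?_ hm
  rw [dist_eq_norm, ← (hc.of_norm_bounded (hpow z hz hbound_lim)).tsum_sub
    (hc.of_norm_bounded (hpow z hz (hbound m)))]
  simp only [← mul_sub]
  have hsum : Summable fun n => R ^ n * ‖d n - d' m n‖ := (hc.mul_left 2).of_norm_bounded (hdist m)
  exact tsum_of_norm_bounded hsum.hasSum (hpow z hz fun n => le_rfl)

section Convergence

open scoped Nat

variable {H ι κ α : Type*} [NormedAddCommGroup H] [InnerProductSpace ℂ H] {l : Filter α}

theorem tendsto_starProjection_of_monotone_of_dense {𝕜 E : Type*} [RCLike 𝕜]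
    [NormedAddCommGroup E] [InnerProductSpace 𝕜 E] [Preorder α] {V : α → Submodule 𝕜 E}
    [∀ m, (V m).HasOrthogonalProjection] (hV : Monotone V) (hdense : Dense (⋃ m, (V m : Set E)))
    (x : E) : Tendsto (fun m => (V m).starProjection x) atTop (𝓝 x) :=
  Submodule.starProjection_tendsto_self V hV x fun v _ =>
    closure_mono (Set.iUnion_subset fun m => le_iSup V m) (hdense v)

theorem HasNuclearExpansion.tendstoUniformlyOn_operatorDet_galerkinProjection [CompleteSpace H]
    {A : H →L[ℂ] H} {x y : κ → H} (hA : HasNuclearExpansion A x y) (e : HilbertBasis ι ℂ H)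
    {V : α → Submodule ℂ H} [∀ m, (V m).HasOrthogonalProjection]
    (hV : ∀ v : H, Tendsto (fun m => (V m).starProjection v) l (𝓝 v)) (R : ℝ) :
    TendstoUniformlyOn (fun m z => operatorDet e (FredholmDet.galerkinProjection (V m) A) z)
      (fun z => operatorDet e A z) l (Metric.closedBall 0 R) := by
  have hnorm : ∀ m k, ‖(V m).starProjection (x k)‖ * ‖(V m).starProjection (y k)‖ ≤
      ‖x k‖ * ‖y k‖ := fun m k => by
    gcongr <;> exact Submodule.norm_starProjection_apply_le _ _
  have hmajorant : Summable fun n => R ^ n * ((∑' k, ‖x k‖ * ‖y k‖) ^ n / n !) := by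
    simpa only [mul_pow, mul_div_assoc] using
      Real.summable_pow_div_factorial (R * ∑' k, ‖x k‖ * ‖y k‖)
  simp only [hA.operatorDet_eq e, (hA.galerkinProjection (V _)).operatorDet_eq e]
  exact tendstoUniformlyOn_tsum_pow_mul hmajorant
    (fun m => norm_expansionTrace_le (hnorm m) hA.summable)
    (tendsto_expansionTrace hnorm hA.summable (fun k => hV (x k)) fun k => hV (y k))

end Convergence

end FredholmDet

theorem theorem5p1_general {H ι α : Type*} [NormedAddCommGroup H] [InnerProductSpace ℂ H]
    [CompleteSpace H] (e : HilbertBasis ι ℂ H) (A : H →L[ℂ] H) (hA : FredholmDet.IsTraceClass A)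
    (V : α → Submodule ℂ H) [∀ m, (V m).HasOrthogonalProjection] {l : Filter α}
    (hV : ∀ x : H, Filter.Tendsto (fun m => (V m).starProjection x) l (nhds x)) :
    FredholmDet.OperatorDetConverges e A ∧
    (∀ m, FredholmDet.OperatorDetConverges e (FredholmDet.galerkinProjection (V m) A)) ∧
    (∀ (m : α) (d : ℕ) (φ : OrthonormalBasis (Fin d) ℂ (V m)) (z : ℂ),
      FredholmDet.operatorDet e (FredholmDet.galerkinProjection (V m) A) z =
        Matrix.det (Matrix.of fun i j : Fin d =>
          (if i = j then 1 else 0) + z * inner ℂ (φ i : H) (A (φ j : H)))) ∧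
    ∀ B : Set ℂ, Bornology.IsBounded B →
      TendstoUniformlyOn
        (fun m z => FredholmDet.operatorDet e (FredholmDet.galerkinProjection (V m) A) z)
        (fun z => FredholmDet.operatorDet e A z) l B := by
  obtain ⟨κ, b, hb⟩ := hA.exists_hilbertBasis_summable_norm
  have hexp := FredholmDet.hasNuclearExpansion_of_hilbertBasis b hb
  refine ⟨hexp.operatorDetConverges e,
    fun m => (hexp.galerkinProjection (V m)).operatorDetConverges e,
    fun m d φ z => hexp.operatorDet_galerkinProjection e φ z, fun B hB => ?_⟩
  obtain ⟨R, hR⟩ := hB.subset_closedBall 0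
  exact (hexp.tendstoUniformlyOn_operatorDet_galerkinProjection e hV R).mono hR

theorem theorem5p1 {H : Type*} [NormedAddCommGroup H] [InnerProductSpace ℂ H] [CompleteSpace H]
    [TopologicalSpace.SeparableSpace H]
    {ι : Type*} (e : HilbertBasis ι ℂ H)
    (A : H →L[ℂ] H) (hA : FredholmDet.IsTraceClass A)
    (V : ℕ → Submodule ℂ H) [∀ m, FiniteDimensional ℂ (V m)]
    (hdense : Dense (⋃ m, (V m : Set H)))
    (hV : Monotone V ∨
      ∀ x : H, Filter.Tendsto (fun m => (V m).starProjection x) Filter.atTop (nhds x)) :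
    FredholmDet.OperatorDetConverges e A ∧
    (∀ m, FredholmDet.OperatorDetConverges e (FredholmDet.galerkinProjection (V m) A)) ∧
    (∀ (m d : ℕ) (φ : OrthonormalBasis (Fin d) ℂ (V m)) (z : ℂ),
      FredholmDet.operatorDet e (FredholmDet.galerkinProjection (V m) A) z =
        Matrix.det (Matrix.of fun i j : Fin d =>
          (if i = j then 1 else 0) + z * inner ℂ (φ i : H) (A (φ j : H)))) ∧
    ∀ B : Set ℂ, Bornology.IsBounded B →
      TendstoUniformlyOn
        (fun m z => FredholmDet.operatorDet e (FredholmDet.galerkinProjection (V m) A) z)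
        (fun z => FredholmDet.operatorDet e A z) Filter.atTop B :=
  theorem5p1_general e A hA V (hV.elim
    (fun hmono => FredholmDet.tendsto_starProjection_of_monotone_of_dense hmono hdense) id)
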